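/- Let $R$ be a commutative ring with unit. Call $R$ absolutely flat (von Neumann regular) if for every $r\in R$ there is $x\in R$ with $r=r^2x$, and semi-artinian if every non-zero homomorphic image of the $R$-module $R$ contains a simple submodule. An $R$-module is superdecomposable if it has no non-zero indecomposable direct summand. Let $\mathrm{D}(R)$ be the unbounded derived category of $R$-modules with its (derived) tensor product. The Bousfield class of $X\in \mathrm{D}(R)$ is $\{Y\in \mathrm{D}(R) \mid X\otimes Y\cong 0\}$, and the cohomological Bousfield class of $X$ is ${}^\perp X=\{Y\in \mathrm{D}(R)\mid \mathrm{Hom}(Y,\Sigma^iX)=0 \text{ for all } i\in\mathbb{Z}\}$. Theorem. Let $R$ be an absolutely flat commutative ring which is not semi-artinian. Then: (1) there exists a non-zero superdecomposable injective $R$-module; (2) for every non-zero superdecomposable injective $R$-module $E$, regarded as an object of $\mathrm{D}(R)$ concentrated in degree $0$, the subcategory ${}^\perp E$ is a localising subcategory of $\mathrm{D}(R)$ (a full triangulated subcategory closed under isomorphisms and small coproducts) which is a cohomological Bousfield class but is not the Bousfield class of any object of $\mathrm{D}(R)$. In particular, $\mathrm{D}(R)$ admits a localising subcategory which is a cohomological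 Bousfield class but not a Bousfield class, so the analogue of Hovey's conjecture (that every cohomological Bousfield class is a Bousfield class) fails for $\mathrm{D}(R)$. -/

import Mathlib

universe u w

/-- A commutative ring `R` is absolutely flat (von Neumann regular) if every `r` is of the form
`r ^ 2 * x`. -/
class IsAbsolutelyFlat (R : Type u) [CommRing R] : Prop where
  exists_eq_sq_mul (r : R) : ∃ x : R, r = r ^ 2 * x

/-- A commutative ring `R` is semi-artinian if every non-zero homomorphic image of the
`R`-module `R` contains a simple submodule. -/
def IsSemiArtinian (R : Type u) [CommRing R] : Prop :=
  ∀ (M : Type u) [AddCommGroup M] [Module R M] (f : R →ₗ[R] M),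
    Function.Surjective f → Nontrivial M → ∃ N : Submodule R M, IsSimpleModule R N

/-- A module is indecomposable if it is non-zero and is not the direct sum of two non-zero
submodules. -/
def IsIndecomposableModule (R : Type u) [CommRing R] (M : Type u) [AddCommGroup M]
    [Module R M] : Prop :=
  Nontrivial M ∧ ∀ A B : Submodule R M, IsCompl A B → A = ⊥ ∨ B = ⊥

/-- A module is superdecomposable if it has no (non-zero) indecomposable direct summand.
The zero module satisfies this vacuously. -/
def IsSuperdecomposable (R : Type u) [CommRing R] (M : Type u) [AddCommGroup M]
    [Module R M] : Prop :=
  ∀ N N' : Submodule R M, IsCompl N N' → ¬ IsIndecomposableModule R N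

/-! ### Tensoring with a complex over an absolutely flat ring preserves quasi-isomorphisms

These auxiliary facts show that the derived tensor product below exists. A complex `K` is an
extension of complexes with zero differential, for which the claim follows from flatness of
all modules. -/

section

open CategoryTheory MonoidalCategory DirectSum

theorem IsAbsolutelyFlat.flat {R : Type u} [CommRing R] [IsAbsolutelyFlat R]
    (M : Type u) [AddCommGroup M] [Module R M] : Module.Flat R M := by
  rw [Module.Flat.iff_rTensor_injective]
  intro I hI
  have hid : IsIdempotentElem I := by
    refine le_antisymm Ideal.mul_le_left ?_
    intro r hr
    obtain ⟨x, hx⟩ := IsAbsolutelyFlat.exists_eq_sq_mul r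
    rw [hx, pow_two]
    exact Ideal.mul_mem_right _ _ (Ideal.mul_mem_mul hr hr)
  obtain ⟨e, he, hIe⟩ := (I.isIdempotentElem_iff_of_fg hI).mp hid
  have heI : e ∈ I := by rw [hIe]; exact Ideal.mem_span_singleton_self e
  let p : R →ₗ[R] I := LinearMap.toSpanSingleton R I ⟨e, heI⟩
  have hp : p ∘ₗ I.subtype = LinearMap.id := by
    ext ⟨x, hx⟩
    rw [hIe] at hx
    obtain ⟨y, rfl⟩ := Ideal.mem_span_singleton'.mp hx
    have h2 : e * e = e := he
    simp [p, mul_assoc, h2]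
  apply Function.LeftInverse.injective (g := p.rTensor M)
  intro z
  rw [← LinearMap.comp_apply, ← LinearMap.rTensor_comp, hp]
  simp

theorem directSum_lmap_exact {R : Type u} [CommRing R] {ι : Type} [DecidableEq ι]
    {A B C : ι → Type u} [∀ i, AddCommGroup (A i)] [∀ i, AddCommGroup (B i)]
    [∀ i, AddCommGroup (C i)] [∀ i, Module R (A i)] [∀ i, Module R (B i)] [∀ i, Module R (C i)]
    (f : ∀ i, A i →ₗ[R] B i) (g : ∀ i, B i →ₗ[R] C i)
    (h : ∀ i, Function.Exact (f i) (g i)) :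
    Function.Exact (DirectSum.lmap f) (DirectSum.lmap g) := by
  classical
  intro z
  constructor
  · intro hz
    have hz' : ∀ i, ∃ x, f i x = z i := fun i => (h i (z i)).mp (by
      rw [← DirectSum.lmap_apply, hz]; rfl)
    choose x hx using hz'
    refine ⟨DFinsupp.mk z.support (fun i => x i), ?_⟩
    apply DFinsupp.ext
    intro i
    change f i (DFinsupp.mk z.support (fun i => x i) i) = z i
    rw [DFinsupp.mk_apply]
    split_ifs with hi
    · exact hx i
    · rw [map_zero]; simpa using (DFinsupp.notMem_support_iff.mp hi).symm
  · rintro ⟨x, rfl⟩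
    apply DFinsupp.ext
    intro i
    exact (h i _).mpr ⟨x i, rfl⟩

variable {R : Type u} [CommRing R]



namespace TensorAux
open HomologicalComplex

/-- Direct sums of families indexed by the integers, with inclusions, and induced maps. -/
noncomputable def dsum (X : ℤ → ModuleCat.{u} R) : ModuleCat.{u} R := ModuleCat.of R (⨁ i, X i)

noncomputable def dι (X : ℤ → ModuleCat.{u} R) (i : ℤ) : X i ⟶ dsum X :=
  ModuleCat.ofHom (DirectSum.lof R ℤ (fun i => X i) i)

noncomputable def ddesc {X : ℤ → ModuleCat.{u} R} {Y : ModuleCat.{u} R} (f : ∀ i, X i ⟶ Y) :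
    dsum X ⟶ Y := ModuleCat.ofHom (DirectSum.toModule R ℤ Y fun i => (f i).hom)

noncomputable def dmap {X Y : ℤ → ModuleCat.{u} R} (f : ∀ i, X i ⟶ Y i) :
    dsum X ⟶ dsum Y := ModuleCat.ofHom (DirectSum.lmap fun i => (f i).hom)

theorem dι_ddesc {X : ℤ → ModuleCat.{u} R} {Y : ModuleCat.{u} R} (f : ∀ i, X i ⟶ Y) (i : ℤ) :
    dι X i ≫ ddesc f = f i := by
  ext x; exact DirectSum.toModule_lof R (φ := fun i => (f i).hom) i x

theorem dι_dmap {X Y : ℤ → ModuleCat.{u} R} (f : ∀ i, X i ⟶ Y i) (i : ℤ) :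
    dι X i ≫ dmap f = f i ≫ dι Y i := by
  ext x; exact DirectSum.lmap_lof (fun i => (f i).hom) i x

theorem dι_ddesc_assoc {X : ℤ → ModuleCat.{u} R} {Y Z : ModuleCat.{u} R} (f : ∀ i, X i ⟶ Y)
    (i : ℤ) (h : Y ⟶ Z) : dι X i ≫ ddesc f ≫ h = f i ≫ h := by
  rw [← Category.assoc, dι_ddesc]

theorem dι_dmap_assoc {X Y : ℤ → ModuleCat.{u} R} {Z : ModuleCat.{u} R} (f : ∀ i, X i ⟶ Y i)
    (i : ℤ) (h : dsum Y ⟶ Z) : dι X i ≫ dmap f ≫ h = f i ≫ dι Y i ≫ h := by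
  rw [← Category.assoc, dι_dmap, Category.assoc]

theorem d_ext {X : ℤ → ModuleCat.{u} R} {Y : ModuleCat.{u} R} {f g : dsum X ⟶ Y}
    (h : ∀ i, dι X i ≫ f = dι X i ≫ g) : f = g := by
  ext : 1
  apply DirectSum.linearMap_ext
  intro i
  exact congrArg ModuleCat.Hom.hom (h i)

/-- The degree `n` part of `K ⊗ A` is the direct sum of the `K.X i ⊗ A.X (n - i)`. -/
noncomputable def tensorXIso (K A : CochainComplex (ModuleCat.{u} R) ℤ) (n : ℤ) :
    (HomologicalComplex.tensorObj K A).X n ≅ dsum (fun i => K.X i ⊗ A.X (n - i)) where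
  hom := mapBifunctorDesc (fun i j h =>
    K.X i ◁ eqToHom (congrArg A.X (show j = n - i from eq_sub_of_add_eq' h)) ≫
      dι (fun i => K.X i ⊗ A.X (n - i)) i)
  inv := ddesc fun i => ιTensorObj K A i (n - i) n (by lia)
  hom_inv_id := by
    apply mapBifunctor.hom_ext
    intro i j h
    obtain rfl : j = n - i := eq_sub_of_add_eq' h
    rw [ι_mapBifunctorDesc_assoc]
    simp [dι_ddesc]
  inv_hom_id := by
    apply d_ext
    intro i
    rw [dι_ddesc_assoc, ι_mapBifunctorDesc]
    simp

theorem ι_hom (K A : CochainComplex (ModuleCat.{u} R) ℤ) (n i : ℤ) (h : i + (n - i) = n) :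
    ιTensorObj K A i (n - i) n h ≫ (tensorXIso K A n).hom =
      dι (fun i => K.X i ⊗ A.X (n - i)) i := by
  simp only [tensorXIso]
  rw [ι_mapBifunctorDesc]
  simp

theorem ι_hom_assoc (K A : CochainComplex (ModuleCat.{u} R) ℤ) (n i : ℤ) (h : i + (n - i) = n)
    {Z : ModuleCat.{u} R} (g : dsum (fun i => K.X i ⊗ A.X (n - i)) ⟶ Z) :
    ιTensorObj K A i (n - i) n h ≫ (tensorXIso K A n).hom ≫ g =
      dι (fun i => K.X i ⊗ A.X (n - i)) i ≫ g := by
  rw [← Category.assoc, ι_hom]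

theorem tensorXIso_hom_map {K L : CochainComplex (ModuleCat.{u} R) ℤ} (f : K ⟶ L)
    {A B : CochainComplex (ModuleCat.{u} R) ℤ} (g : A ⟶ B) (n : ℤ) :
    (HomologicalComplex.tensorHom f g).f n ≫ (tensorXIso L B n).hom = (tensorXIso K A n).hom ≫
      dmap (fun i => f.f i ⊗ₘ g.f (n - i)) := by
  apply mapBifunctor.hom_ext
  intro i j h
  obtain rfl : j = n - i := eq_sub_of_add_eq' h
  rw [ι_mapBifunctorMap_assoc, ι_hom, ι_hom_assoc, dι_dmap, MonoidalCategory.tensorHom_def]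
  simp

theorem tensorXIso_hom_d (K A : CochainComplex (ModuleCat.{u} R) ℤ) (hK : ∀ i j, K.d i j = 0)
     (n m : ℤ) (hnm : n + 1 = m) :
    (HomologicalComplex.tensorObj K A).d n m ≫ (tensorXIso K A m).hom = (tensorXIso K A n).hom ≫
      dmap (fun i => i.negOnePow • (K.X i ◁ A.d (n - i) (m - i))) := by
  apply mapBifunctor.hom_ext
  intro i j h
  obtain rfl : j = n - i := eq_sub_of_add_eq' h
  rw [mapBifunctor.d_eq, Preadditive.add_comp, Preadditive.comp_add, mapBifunctor.ι_D₁_assoc,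
    mapBifunctor.ι_D₂_assoc, ι_hom_assoc, dι_dmap,
    mapBifunctor.d₁_eq K A (curriedTensor (ModuleCat R)) (ComplexShape.up ℤ) (show (ComplexShape.up ℤ).Rel i (i+1) from rfl) _ _ (show i + 1 + (n - i) = m by lia),
    mapBifunctor.d₂_eq K A (curriedTensor (ModuleCat R)) (ComplexShape.up ℤ) i (show (ComplexShape.up ℤ).Rel (n-i) (m-i) from by simp; lia) _ (show i + (m - i) = m by lia)]
  simp [hK]
  rw [ι_hom]

/-- Quasi-isomorphisms of short complexes of modules in terms of elements. -/
theorem quasiIso_iff_elem {S T : ShortComplex (ModuleCat.{u} R)} (φ : S ⟶ T) :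
    ShortComplex.QuasiIso φ ↔
      (∀ (z : S.X₂) (y : T.X₁), S.g z = 0 → T.f y = φ.τ₂ z → ∃ x, S.f x = z) ∧
      (∀ w : T.X₂, T.g w = 0 → ∃ (z : S.X₂) (y : T.X₁), S.g z = 0 ∧ T.f y = w - φ.τ₂ z) := by
  let γ : ShortComplex.LeftHomologyMapData φ S.moduleCatLeftHomologyData
    T.moduleCatLeftHomologyData := default
  rw [γ.quasiIso_iff, ConcreteCategory.isIso_iff_bijective]
  have key : ∀ U : ShortComplex (ModuleCat.{u} R),
      (∀ z, U.g z = 0 → ∃ c, U.moduleCatLeftHomologyData.i c = z) ∧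
      (∀ c, U.g (U.moduleCatLeftHomologyData.i c) = 0) ∧
      (∀ c, U.moduleCatLeftHomologyData.π c = 0 ↔
        ∃ x, U.f x = U.moduleCatLeftHomologyData.i c) ∧
      Function.Surjective U.moduleCatLeftHomologyData.π := fun U =>
    ⟨fun z hz => ⟨⟨z, hz⟩, rfl⟩, fun c => c.2, fun c =>
      (Submodule.Quotient.mk_eq_zero (LinearMap.range U.moduleCatToCycles)).trans
        (exists_congr fun x => Subtype.ext_iff),
      Submodule.Quotient.mk_surjective (LinearMap.range U.moduleCatToCycles)⟩
  obtain ⟨hS1, hS2, hS3, hS4⟩ := key S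
  obtain ⟨hT1, hT2, hT3, hT4⟩ := key T
  have hπ : ∀ z, γ.φH (S.moduleCatLeftHomologyData.π z) = T.moduleCatLeftHomologyData.π (γ.φK z) :=
    fun z => congr($(γ.commπ) z)
  have hi : ∀ z, T.moduleCatLeftHomologyData.i (γ.φK z) =
      φ.τ₂ (S.moduleCatLeftHomologyData.i z) := fun z => congr($(γ.commi) z)
  clear_value γ
  generalize S.moduleCatLeftHomologyData = hS at *
  generalize T.moduleCatLeftHomologyData = hT at *
  refine and_congr ?_ ?_
  · rw [injective_iff_map_eq_zero]
    constructor
    · intro h z y hz hy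
      obtain ⟨c, rfl⟩ := hS1 z hz
      refine (hS3 c).1 (h _ ?_)
      rw [hπ, hT3]
      exact ⟨y, hy.trans (hi _).symm⟩
    · intro h a ha
      obtain ⟨z, rfl⟩ := hS4 a
      rw [hπ, hT3] at ha
      obtain ⟨y, hy⟩ := ha
      rw [hS3]
      exact h _ y (hS2 z) (hy.trans (hi _))
  · constructor
    · intro h w hw
      obtain ⟨c, rfl⟩ := hT1 w hw
      obtain ⟨a, ha⟩ := h (hT.π c)
      obtain ⟨z, rfl⟩ := hS4 a
      have : hT.π (c - γ.φK z) = 0 := by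
        rw [map_sub, ← ha, hπ, sub_self]
      obtain ⟨y, hy⟩ := (hT3 _).1 this
      exact ⟨_, y, hS2 z, hy.trans (by rw [map_sub, hi])⟩
    · intro h b
      obtain ⟨w, rfl⟩ := hT4 b
      obtain ⟨z, y, hz, hy⟩ := h _ (hT2 w)
      obtain ⟨c, rfl⟩ := hS1 z hz
      refine ⟨hS.π c, ?_⟩
      rw [hπ, ← sub_eq_zero, ← map_sub, hT3]
      exact ⟨-y, by rw [map_neg, hy, map_sub, hi, neg_sub]⟩


/-- The direct sum of a family of short complexes. -/
noncomputable def dS (S : ℤ → ShortComplex (ModuleCat.{u} R)) : ShortComplex (ModuleCat.{u} R) :=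
  ShortComplex.mk (dmap fun i => (S i).f) (dmap fun i => (S i).g) (by
    apply d_ext
    intro i
    rw [dι_dmap_assoc, dι_dmap, ShortComplex.zero_assoc]
    simp)

theorem dS_shortExact (S : ℤ → ShortComplex (ModuleCat.{u} R)) (h : ∀ i, (S i).ShortExact) :
    (dS S).ShortExact where
  exact := by
    rw [ShortComplex.ShortExact.moduleCat_exact_iff_function_exact]
    exact directSum_lmap_exact _ _ fun i =>
      (ShortComplex.ShortExact.moduleCat_exact_iff_function_exact (S i)).1 (h i).exact
  mono_f := (ModuleCat.mono_iff_injective _).2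
    ((DirectSum.lmap_injective _).2 fun i => (h i).moduleCat_injective_f)
  epi_g := (ModuleCat.epi_iff_surjective _).2
    ((DirectSum.lmap_surjective _).2 fun i => (h i).moduleCat_surjective_g)

noncomputable def dSmap {S T : ℤ → ShortComplex (ModuleCat.{u} R)} (φ : ∀ i, S i ⟶ T i) : dS S ⟶ dS T where
  τ₁ := dmap fun i => (φ i).τ₁
  τ₂ := dmap fun i => (φ i).τ₂
  τ₃ := dmap fun i => (φ i).τ₃
  comm₁₂ := by
    apply d_ext
    intro i
    simp [dS, dι_dmap_assoc, dι_dmap, (φ i).comm₁₂_assoc]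
  comm₂₃ := by
    apply d_ext
    intro i
    simp [dS, dι_dmap_assoc, dι_dmap, (φ i).comm₂₃_assoc]

theorem dSmap_quasiIso {S T : ℤ → ShortComplex (ModuleCat.{u} R)} (φ : ∀ i, S i ⟶ T i)
    (h : ∀ i, ShortComplex.QuasiIso (φ i)) : ShortComplex.QuasiIso (dSmap φ) := by
  classical
  simp only [quasiIso_iff_elem] at h ⊢
  constructor
  · intro (z : ⨁ i, (S i).X₂) (y : ⨁ i, (T i).X₁) hz hy
    have : ∀ i, ∃ x, (S i).f x = z i := fun i => (h i).1 (z i) (y i)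
      (congrArg (fun x : ⨁ i, (S i).X₃ => x i) hz)
      (congrArg (fun x : ⨁ i, (T i).X₂ => x i) hy)
    choose x hx using this
    refine ⟨DFinsupp.mk z.support (fun i => x i), ?_⟩
    apply DFinsupp.ext
    intro i
    change (S i).f (DFinsupp.mk (β := fun i => (S i).X₁) z.support (fun i => x i) i) = z i
    rw [DFinsupp.mk_apply]
    split_ifs with hi
    · exact hx i
    · rw [map_zero]; exact (DFinsupp.notMem_support_iff.mp hi).symm
  · intro (w : ⨁ i, (T i).X₂) hw
    have : ∀ i, ∃ (z : (S i).X₂) (y : (T i).X₁), (S i).g z = 0 ∧ (T i).f y = w i - (φ i).τ₂ z :=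
      fun i => (h i).2 (w i) (congrArg (fun x : ⨁ i, (T i).X₃ => x i) hw)
    choose z y hz hy using this
    refine ⟨DFinsupp.mk w.support (fun i => z i), DFinsupp.mk w.support (fun i => y i), ?_, ?_⟩
    · apply DFinsupp.ext
      intro i
      change (S i).g (DFinsupp.mk (β := fun i => (S i).X₂) w.support (fun i => z i) i) = 0
      rw [DFinsupp.mk_apply]
      split_ifs with hi
      · exact hz i
      · rw [map_zero]
    · apply DFinsupp.ext
      intro i
      change (T i).f (DFinsupp.mk (β := fun i => (T i).X₁) w.support (fun i => y i) i) =
        w i - (φ i).τ₂ (DFinsupp.mk (β := fun i => (S i).X₂) w.support (fun i => z i) i)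
      rw [DFinsupp.mk_apply, DFinsupp.mk_apply]
      split_ifs with hi
      · exact hy i
      · rw [map_zero, map_zero, sub_zero]; exact (DFinsupp.notMem_support_iff.mp hi).symm

/-- Change the two differentials of a short complex by a common sign. -/
def sgn (ε : ℤˣ) (S : ShortComplex (ModuleCat.{u} R)) : ShortComplex (ModuleCat.{u} R) :=
  ShortComplex.mk (ε • S.f) (ε • S.g) (by simp)

def sgnMap (ε : ℤˣ) {S T : ShortComplex (ModuleCat.{u} R)} (φ : S ⟶ T) : sgn ε S ⟶ sgn ε T where
  τ₁ := φ.τ₁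
  τ₂ := φ.τ₂
  τ₃ := φ.τ₃
  comm₁₂ := by simp [sgn, φ.comm₁₂]
  comm₂₃ := by simp [sgn, φ.comm₂₃]

theorem sgnMap_quasiIso (ε : ℤˣ) {S T : ShortComplex (ModuleCat.{u} R)} (φ : S ⟶ T)
    (h : ShortComplex.QuasiIso φ) : ShortComplex.QuasiIso (sgnMap ε φ) := by
  rw [quasiIso_iff_elem] at h ⊢
  obtain rfl | rfl := Int.units_eq_one_or ε
  · have e : ∀ S : ShortComplex (ModuleCat.{u} R), (sgn 1 S).f = S.f ∧ (sgn 1 S).g = S.g :=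
      fun S => ⟨one_smul _ _, one_smul _ _⟩
    rw [(e S).1, (e S).2, (e T).1, (e T).2]
    exact h
  · have e : ∀ S : ShortComplex (ModuleCat.{u} R), (∀ x, (sgn (-1) S).f x = -(S.f x)) ∧
        (∀ x, (sgn (-1) S).g x = -(S.g x)) := fun S =>
      ⟨fun x => by simp [sgn, Units.smul_def]; rfl, fun x => by simp [sgn, Units.smul_def]; rfl⟩
    simp only [(e S).1, (e S).2, (e T).1, (e T).2]
    refine ⟨fun z y hz hy => ?_, fun w hw => ?_⟩
    · obtain ⟨x, hx⟩ := h.1 z (-y) (neg_eq_zero.1 hz) ((map_neg T.f.hom y).trans hy)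
      exact ⟨-x, (congrArg Neg.neg (map_neg S.f.hom x)).trans ((neg_neg _).trans hx)⟩
    · obtain ⟨z, y, hz, hy⟩ := h.2 w (neg_eq_zero.1 hw)
      exact ⟨z, -y, (congrArg Neg.neg hz).trans neg_zero,
        (congrArg Neg.neg (map_neg T.f.hom y)).trans ((neg_neg _).trans hy)⟩

theorem quasiIso_τ₂ {S T : ShortComplex (CochainComplex (ModuleCat.{u} R) ℤ)} (φ : S ⟶ T)
    (hS : S.ShortExact) (hT : T.ShortExact) (h₁ : QuasiIso φ.τ₁) (h₃ : QuasiIso φ.τ₃) :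
    QuasiIso φ.τ₂ := by
  rw [quasiIso_iff]
  intro i
  rw [quasiIsoAt_iff_isIso_homologyMap]
  have : Mono (homologyMap φ.τ₂ i) := by
    have hij : (ComplexShape.up ℤ).Rel (i-1) i := by simp
    exact Abelian.mono_of_epi_of_mono_of_mono'' (k := 2) (by lia)
      (HomologySequence.composableArrows₅_exact hS _ _ hij)
      (HomologySequence.composableArrows₅_exact hT _ _ hij)
      (HomologySequence.mapComposableArrows₅ φ hS hT (i - 1) i hij) 2 3 4 5 rfl rfl rfl rfl
      (show Epi (homologyMap φ.τ₃ (i-1)) from inferInstance)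
      (show Mono (homologyMap φ.τ₁ i) from inferInstance)
      (show Mono (homologyMap φ.τ₃ i) from inferInstance)
  have : Epi (homologyMap φ.τ₂ i) := by
    have hij : (ComplexShape.up ℤ).Rel i (i+1) := by simp
    exact Abelian.epi_of_epi_of_epi_of_mono'' (k := 0) (by lia)
      (HomologySequence.composableArrows₅_exact hS _ _ hij)
      (HomologySequence.composableArrows₅_exact hT _ _ hij)
      (HomologySequence.mapComposableArrows₅ φ hS hT i (i+1) hij) 0 1 2 3 rfl rfl rfl rfl
      (show Epi (homologyMap φ.τ₁ i) from inferInstance)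
      (show Epi (homologyMap φ.τ₃ i) from inferInstance)
      (show Mono (homologyMap φ.τ₁ (i+1)) from inferInstance)
  exact isIso_of_mono_of_epi _

/-- The cycles of a complex, as a subcomplex with zero differential. -/
def cyc (K : CochainComplex (ModuleCat.{u} R) ℤ) : CochainComplex (ModuleCat.{u} R) ℤ where
  X i := ModuleCat.of R (LinearMap.ker (K.d i (i + 1)).hom)
  d _ _ := 0

/-- The quotient of a complex by its cycles; its differential vanishes. -/
def coim (K : CochainComplex (ModuleCat.{u} R) ℤ) : CochainComplex (ModuleCat.{u} R) ℤ where
  X i := ModuleCat.of R (K.X i ⧸ LinearMap.ker (K.d i (i + 1)).hom)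
  d _ _ := 0

/-- The short exact sequence formed by the cycles and their quotient. -/
def cycSeq (K : CochainComplex (ModuleCat.{u} R) ℤ) :
    ShortComplex (CochainComplex (ModuleCat.{u} R) ℤ) where
  X₁ := cyc K
  X₂ := K
  X₃ := coim K
  f :=
    { f i := ModuleCat.ofHom (LinearMap.ker (K.d i (i + 1)).hom).subtype
      comm' i j hij := by
        obtain rfl : i + 1 = j := hij
        ext x
        exact x.2 }
  g :=
    { f i := ModuleCat.ofHom (LinearMap.ker (K.d i (i + 1)).hom).mkQ
      comm' i j hij := by
        obtain rfl : i + 1 = j := hij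
        ext x
        refine Eq.symm ((Submodule.Quotient.mk_eq_zero _).2 ?_)
        exact congr($(K.d_comp_d i (i + 1) (i + 1 + 1)) x) }
  zero := by
    ext i x
    exact (Submodule.Quotient.mk_eq_zero _).2 x.2

theorem cycSeq_shortExact (K : CochainComplex (ModuleCat.{u} R) ℤ) : (cycSeq K).ShortExact := by
  apply shortExact_of_degreewise_shortExact
  intro n
  exact
    { exact := (ShortComplex.ShortExact.moduleCat_exact_iff_function_exact _).2
        (LinearMap.exact_subtype_mkQ _)
      mono_f := (ModuleCat.mono_iff_injective _).2 (Submodule.injective_subtype _)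
      epi_g := (ModuleCat.epi_iff_surjective _).2 (Submodule.mkQ_surjective _) }

/-- The tensor product of a short complex of complexes with the complex `A`. -/
noncomputable def seq (S : ShortComplex (CochainComplex (ModuleCat.{u} R) ℤ))
    (A : CochainComplex (ModuleCat.{u} R) ℤ) : ShortComplex (CochainComplex (ModuleCat.{u} R) ℤ) :=
  ShortComplex.mk (HomologicalComplex.tensorHom S.f (𝟙 A)) (HomologicalComplex.tensorHom S.g (𝟙 A)) (by
    ext n : 1
    apply mapBifunctor.hom_ext
    intro i j h
    rw [comp_f, ι_mapBifunctorMap_assoc]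
    have : S.f.f i ≫ S.g.f i = 0 := by rw [← comp_f, S.zero]; rfl
    simp [← comp_whiskerRight_assoc, this])

section
variable [IsAbsolutelyFlat R]

theorem seq_shortExact {S : ShortComplex (CochainComplex (ModuleCat.{u} R) ℤ)} (hS : S.ShortExact)
    (A : CochainComplex (ModuleCat.{u} R) ℤ) : (seq S A).ShortExact := by
  apply shortExact_of_degreewise_shortExact
  intro n
  have hc : ∀ i, ((S.map (eval _ _ i)).map (tensorRight (A.X (n - i)))).ShortExact := fun i => by
    have h := hS.map_of_exact (eval _ _ i)
    have := IsAbsolutelyFlat.flat (R := R) (A.X (n - i))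
    exact
      { exact := Module.Flat.rTensor_shortComplex_exact _ _ h.exact
        mono_f := (ModuleCat.mono_iff_injective _).2
          (Module.Flat.rTensor_preserves_injective_linearMap (M := A.X (n - i)) _
            h.moduleCat_injective_f)
        epi_g := (ModuleCat.epi_iff_surjective _).2
          (LinearMap.rTensor_surjective (A.X (n - i)) h.moduleCat_surjective_g) }
  refine ShortComplex.shortExact_of_iso ?_ (dS_shortExact _ hc)
  refine (ShortComplex.isoMk (tensorXIso _ _ _) (tensorXIso _ _ _) (tensorXIso _ _ _) ?_ ?_).symm
  · refine Eq.trans ?_ (tensorXIso_hom_map S.f (𝟙 A) n).symm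
    simp [dS]
    rfl
  · refine Eq.trans ?_ (tensorXIso_hom_map S.g (𝟙 A) n).symm
    simp [dS]
    rfl

theorem quasiIso_of_d_eq_zero (K : CochainComplex (ModuleCat.{u} R) ℤ) (hK : ∀ i j, K.d i j = 0)
    {A B : CochainComplex (ModuleCat.{u} R) ℤ} (f : A ⟶ B) [QuasiIso f] :
    QuasiIso (HomologicalComplex.tensorHom (𝟙 K) f) := by
  rw [quasiIso_iff]
  intro n
  rw [quasiIsoAt_iff' _ (n - 1) n (n + 1) (by simp) (by simp)]
  let S : CochainComplex (ModuleCat.{u} R) ℤ → ℤ → ShortComplex (ModuleCat.{u} R) := fun A i =>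
    sgn i.negOnePow ((A.sc' (n - 1 - i) (n - i) (n + 1 - i)).map (tensorLeft (K.X i)))
  let φ : ∀ i, S A i ⟶ S B i := fun i => sgnMap i.negOnePow
    ((tensorLeft (K.X i)).mapShortComplex.map ((shortComplexFunctor' _ _ (n - 1 - i) (n - i) (n + 1 - i)).map f))
  have hφ : ∀ i, ShortComplex.QuasiIso (φ i) := by
    intro i
    apply sgnMap_quasiIso
    have h1 : ShortComplex.QuasiIso ((shortComplexFunctor' _ _ (n - 1 - i) (n - i) (n + 1 - i)).map f) := by
      rw [← quasiIsoAt_iff' f _ _ _ (by simp; lia) (by simp; lia)]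
      infer_instance
    have := IsAbsolutelyFlat.flat (R := R) (K.X i)
    have : (tensorLeft (K.X i)).PreservesHomology :=
      (tensorLeft (K.X i)).preservesHomology_of_map_exact fun C hC =>
        Module.Flat.lTensor_shortComplex_exact _ C hC
    exact ShortComplex.quasiIso_map_of_preservesLeftHomology _ _
  let e : ∀ A, (HomologicalComplex.tensorObj K A).sc' (n - 1) n (n + 1) ≅ dS (S A) := fun A =>
    ShortComplex.isoMk (tensorXIso _ _ _) (tensorXIso _ _ _) (tensorXIso _ _ _)
      (tensorXIso_hom_d K A hK _ _ (by lia)).symm (tensorXIso_hom_d K A hK _ _ (by lia)).symm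
  have hm : ∀ m : ℤ, (tensorXIso K A m).hom ≫ dmap (fun i => K.X i ◁ f.f (m - i)) =
      (HomologicalComplex.tensorHom (𝟙 K) f).f m ≫ (tensorXIso K B m).hom := fun m => by
    rw [tensorXIso_hom_map]
    simp
  refine (ShortComplex.quasiIso_iff_of_arrow_mk_iso _ (dSmap φ)
    (Arrow.isoMk (e A) (e B) ?_)).2 (dSmap_quasiIso φ hφ)
  ext1
  · exact hm (n - 1)
  · exact hm n
  · exact hm (n + 1)

/-- Over an absolutely flat ring, tensoring with any complex preserves quasi-isomorphisms. -/
theorem quasiIso_tensorHom (K : CochainComplex (ModuleCat.{u} R) ℤ)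
    {A B : CochainComplex (ModuleCat.{u} R) ℤ} (f : A ⟶ B) [QuasiIso f] :
    QuasiIso (HomologicalComplex.tensorHom (𝟙 K) f) := by
  have hc : ∀ {K L : CochainComplex (ModuleCat.{u} R) ℤ} (g : K ⟶ L),
      HomologicalComplex.tensorHom (𝟙 K) f ≫ HomologicalComplex.tensorHom g (𝟙 B) =
        HomologicalComplex.tensorHom g (𝟙 A) ≫ HomologicalComplex.tensorHom (𝟙 L) f :=
    fun {K L} g => whisker_exchange g f
  let φ : seq (cycSeq K) A ⟶ seq (cycSeq K) B :=
    { τ₁ := HomologicalComplex.tensorHom (𝟙 (cyc K)) f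
      τ₂ := HomologicalComplex.tensorHom (𝟙 K) f
      τ₃ := HomologicalComplex.tensorHom (𝟙 (coim K)) f
      comm₁₂ := hc _
      comm₂₃ := hc _ }
  exact quasiIso_τ₂ φ (seq_shortExact (cycSeq_shortExact K) A)
    (seq_shortExact (cycSeq_shortExact K) B)
    (quasiIso_of_d_eq_zero _ (fun _ _ => rfl) f) (quasiIso_of_d_eq_zero _ (fun _ _ => rfl) f)

end

end TensorAux

/-- The functor `M ↦ K ⊗ M` from complexes to `D(R)` inverts quasi-isomorphisms. -/
theorem tensorLeft_isInvertedBy [IsAbsolutelyFlat R] [HasDerivedCategory.{w} (ModuleCat.{u} R)]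
    (K : CochainComplex (ModuleCat.{u} R) ℤ) :
    (HomologicalComplex.quasiIso (ModuleCat.{u} R) (ComplexShape.up ℤ)).IsInvertedBy
      (tensorLeft K ⋙ DerivedCategory.Q) := by
  intro A B f hf
  have : QuasiIso f := hf
  have : QuasiIso ((tensorLeft K).map f) := TensorAux.quasiIso_tensorHom K f
  rw [Functor.comp_map]
  infer_instance

instance hasLeftDerivedFunctor_tensorLeft [IsAbsolutelyFlat R]
    [HasDerivedCategory.{w} (ModuleCat.{u} R)] (K : CochainComplex (ModuleCat.{u} R) ℤ) :
    (tensorLeft K ⋙ DerivedCategory.Q).HasLeftDerivedFunctor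
      (HomologicalComplex.quasiIso (ModuleCat.{u} R) (ComplexShape.up ℤ)) :=
  Functor.HasLeftDerivedFunctor.mk'
    (Localization.lift _ (tensorLeft_isInvertedBy K) DerivedCategory.Q)
    (Localization.fac _ (tensorLeft_isInvertedBy K) DerivedCategory.Q).hom

end

/-! ### Bousfield classes in the derived category -/

section

open CategoryTheory MonoidalCategory

variable {R : Type u} [CommRing R] [HasDerivedCategory.{w} (ModuleCat.{u} R)]

/-- The derived tensor product `X ⊗ (-) : D(R) ⥤ D(R)`: the total left derived functor of the
tensor product with a complex representing `X`. -/
noncomputable def derivedTensor [IsAbsolutelyFlat R] (X : DerivedCategory (ModuleCat.{u} R)) :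
    DerivedCategory (ModuleCat.{u} R) ⥤ DerivedCategory (ModuleCat.{u} R) :=
  (tensorLeft (DerivedCategory.Q.objPreimage X) ⋙ DerivedCategory.Q).totalLeftDerived
    DerivedCategory.Q (HomologicalComplex.quasiIso (ModuleCat.{u} R) (ComplexShape.up ℤ))

/-- A localising subcategory of `D(R)`: a full (replete) triangulated subcategory closed under
all small coproducts. -/
structure IsLocalising (L : ObjectProperty (DerivedCategory (ModuleCat.{u} R))) : Prop where
  isTriangulated : L.IsTriangulated
  isClosedUnderIsomorphisms : L.IsClosedUnderIsomorphisms
  isClosedUnderCoproducts (J : Type u) : L.IsClosedUnderColimitsOfShape (Discrete J)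

/-- The Bousfield class of `X`: the objects `Y` with `X ⊗ Y ≅ 0`. -/
def bousfieldClass [IsAbsolutelyFlat R] (X : DerivedCategory (ModuleCat.{u} R)) :
    ObjectProperty (DerivedCategory (ModuleCat.{u} R)) :=
  fun Y => Limits.IsZero ((derivedTensor X).obj Y)

/-- The cohomological Bousfield class `⊥X` of `X`: the objects `Y` such that
`Hom(Y, X[i]) = 0` for every integer `i`. -/
def cohomologicalBousfieldClass (X : DerivedCategory (ModuleCat.{u} R)) :
    ObjectProperty (DerivedCategory (ModuleCat.{u} R)) :=
  fun Y => ∀ (i : ℤ) (f : Y ⟶ (shiftFunctor (DerivedCategory (ModuleCat.{u} R)) i).obj X), f = 0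

/-- `L` is the Bousfield class of some object of `D(R)`. -/
def IsBousfieldClass [IsAbsolutelyFlat R]
    (L : ObjectProperty (DerivedCategory (ModuleCat.{u} R))) : Prop :=
  ∃ X : DerivedCategory (ModuleCat.{u} R), L = bousfieldClass X

/-- `L` is the cohomological Bousfield class of some object of `D(R)`. -/
def IsCohomologicalBousfieldClass
    (L : ObjectProperty (DerivedCategory (ModuleCat.{u} R))) : Prop :=
  ∃ X : DerivedCategory (ModuleCat.{u} R), L = cohomologicalBousfieldClass X

/-- An `R`-module, seen as an object of `D(R)` concentrated in degree `0`. -/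
noncomputable def moduleInDerived (E : Type u) [AddCommGroup E] [Module R E] :
    DerivedCategory (ModuleCat.{u} R) :=
  (DerivedCategory.singleFunctor (ModuleCat.{u} R) 0).obj (ModuleCat.of R E)

end

/-! ### Idempotents, indecomposable modules and simple modules over an absolutely flat ring. -/

section AbsolutelyFlat

open Submodule

variable {R : Type u} [CommRing R]

/-! Over an absolutely flat ring each principal ideal is generated by an idempotent. Hence simple
modules are injective, and a simple submodule of any module splits off; so a superdecomposable `E`
has no simple submodule and Hom(R/m, E) = 0 for every maximal ideal m. If `E` is also injective, the
positive Ext groups vanish too, and every R/m lies in ⊥E.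

Suppose ⊥E were the Bousfield class of X. Then X ⊗ R/m is acyclic for all m. Since R → R/m is
surjective and injective after localizing at m, X ⊗ R is acyclic locally, hence acyclic
(`bousfieldClass_self_of_residue`). So R lies in ⊥E, and E ≅ Hom(R, E) = 0, a contradiction.

For existence, failure of semi-artinianity provides a nonzero module with no simple submodule. Its
injective hull is superdecomposable: an indecomposable summand would meet the module nontrivially,
and cyclic submodules of indecomposables are simple because idempotents act on them as 0 or 1. -/

theorem IsAbsolutelyFlat.exists_idempotent [IsAbsolutelyFlat R] (r : R) :
    ∃ s : R, r * s * (r * s) = r * s ∧ r * s * r = r := by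
  obtain ⟨s, hs⟩ := IsAbsolutelyFlat.exists_eq_sq_mul r
  have h : r * s * r = r := by linear_combination -hs
  exact ⟨s, by rw [← mul_assoc, h], h⟩

/-- An idempotent acts on an indecomposable module as zero or as the identity. -/
theorem IsIndecomposableModule.idempotent_smul {N : Type u} [AddCommGroup N] [Module R N]
    (hN : IsIndecomposableModule R N) {e : R} (he : e * e = e) :
    (∀ x : N, e • x = 0) ∨ ∀ x : N, e • x = x := by
  -- Peirce decomposition: the kernel of `e` is the image of `1 - e`.
  have hc : IsCompl (LinearMap.range (LinearMap.lsmul R N e))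
      (LinearMap.ker (LinearMap.lsmul R N e)) := by
    refine IsCompl.of_eq ((Submodule.eq_bot_iff _).2 ?_) ((Submodule.eq_top_iff').2 ?_)
    · rintro _ ⟨⟨y, rfl⟩, hx⟩
      have h : e • e • y = 0 := hx
      rw [smul_smul, he] at h
      exact h
    · intro x
      refine Submodule.mem_sup.2 ⟨e • x, ⟨x, rfl⟩, x - e • x, ?_, by abel⟩
      change e • (x - e • x) = 0
      rw [smul_sub, smul_smul, he, sub_self]
  rcases hN.2 _ _ hc with h | h
  · exact Or.inl fun x => (Submodule.eq_bot_iff _).1 h _ ⟨x, rfl⟩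
  · refine Or.inr fun x => (sub_eq_zero.1 ((Submodule.eq_bot_iff _).1 h (x - e • x) ?_)).symm
    change e • (x - e • x) = 0
    rw [smul_sub, smul_smul, he, sub_self]

theorem isSimpleModule_of_forall_mem_span {M : Type u} [AddCommGroup M] [Module R M]
    {S : Submodule R M} (hS : S ≠ ⊥) (h : ∀ y ∈ S, y ≠ 0 → S ≤ R ∙ y) : IsSimpleModule R S := by
  rw [isSimpleModule_iff_isAtom]
  refine ⟨hS, fun T hT => by_contra fun hT0 => ?_⟩
  obtain ⟨y, hy, hy0⟩ := (Submodule.ne_bot_iff _).1 hT0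
  exact hT.not_ge ((h y (hT.le hy) hy0).trans ((span_singleton_le_iff_mem _ _).2 hy))

/-- Cyclic submodules of an indecomposable module over an absolutely flat ring are simple. -/
theorem IsIndecomposableModule.isSimpleModule_span [IsAbsolutelyFlat R]
    {M : Type u} [AddCommGroup M] [Module R M] {N : Submodule R M}
    (hN : IsIndecomposableModule R N) {x : M} (hx : x ∈ N) (hx0 : x ≠ 0) :
    IsSimpleModule R (R ∙ x) := by
  refine isSimpleModule_of_forall_mem_span (by simpa using hx0) fun y hy hy0 => ?_
  obtain ⟨r, rfl⟩ := mem_span_singleton.1 hy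
  obtain ⟨s, he, hr⟩ := IsAbsolutelyFlat.exists_idempotent r
  rw [span_singleton_le_iff_mem, mem_span_singleton]
  refine ⟨s, ?_⟩
  rw [smul_smul, mul_comm]
  -- If `r * s` acts as zero, then `r • x = (r * s * r) • x` vanishes, which is excluded; if it acts
  -- as the identity, `s` undoes `r`.
  rcases hN.idempotent_smul he with h | h
  · refine absurd ?_ hy0
    rw [← hr, mul_comm, mul_smul, show (r * s) • x = 0 from congrArg Subtype.val (h ⟨x, hx⟩),
      smul_zero]
  · exact congrArg Subtype.val (h ⟨x, hx⟩)

/-- Simple modules over an absolutely flat ring are injective. -/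
theorem IsAbsolutelyFlat.injective_of_isSimpleModule [IsAbsolutelyFlat R]
    (S : Type u) [AddCommGroup S] [Module R S] [IsSimpleModule R S] : Module.Injective R S := by
  apply Module.Baer.injective
  intro I f
  have hm := IsSimpleModule.annihilator_isMaximal (R := R) (M := S)
  have hmem : ∀ {a : R}, a ∈ Module.annihilator R S ↔ ∀ s : S, a • s = 0 :=
    Module.mem_annihilator
  -- Baer's criterion. If `I` kills `S`, then `f r = r • f (s * r) = 0`, so `f` extends by zero.
  -- Otherwise `I` contains an idempotent `e = a * s` such that `1 - e` kills `S`, since the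
  -- annihilator is prime; then `r ↦ r • f e` extends `f`.
  by_cases hI : I ≤ Module.annihilator R S
  · refine ⟨0, fun r hr => ?_⟩
    obtain ⟨s, -, h⟩ := IsAbsolutelyFlat.exists_idempotent r
    have : (⟨r, hr⟩ : I) = r • (⟨s * r, I.mul_mem_left _ hr⟩ : I) :=
      Subtype.ext (by change r = r * (s * r); rw [← mul_assoc, h])
    rw [this, map_smul, hmem.1 (hI hr)]
    rfl
  · obtain ⟨a, ha, ha'⟩ := Set.not_subset.1 hI
    obtain ⟨s, he, h⟩ := IsAbsolutelyFlat.exists_idempotent a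
    have heI : a * s ∈ I := I.mul_mem_right _ ha
    have he' : 1 - a * s ∈ Module.annihilator R S := by
      refine (hm.isPrime.mem_or_mem (x := a) (y := 1 - a * s) ?_).resolve_left ha'
      rw [show a * (1 - a * s) = 0 by linear_combination -h]
      exact zero_mem _
    refine ⟨LinearMap.toSpanSingleton R S (f ⟨a * s, heI⟩), fun r hr => ?_⟩
    have h1 : r • f ⟨a * s, heI⟩ = (a * s) • f ⟨r, hr⟩ := by
      rw [← map_smul, ← map_smul]
      exact congrArg f (Subtype.ext (mul_comm _ _))
    have h2 := hmem.1 he' (f ⟨r, hr⟩)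
    rw [sub_smul, one_smul, sub_eq_zero] at h2
    rw [LinearMap.toSpanSingleton_apply, h1, ← h2]

/-- A superdecomposable module over an absolutely flat ring has no simple submodule. -/
theorem IsSuperdecomposable.not_isSimpleModule [IsAbsolutelyFlat R]
    {E : Type u} [AddCommGroup E] [Module R E] (hE : IsSuperdecomposable R E)
    (S : Submodule R E) : ¬ IsSimpleModule R S := by
  intro hS
  have := IsAbsolutelyFlat.injective_of_isSimpleModule (R := R) S
  -- Injectivity of `S` gives a retraction `E → S`, making `S` a direct summand; simple modules are
  -- indecomposable.
  obtain ⟨p, hp⟩ := Module.Injective.out S.subtype S.injective_subtype (LinearMap.id (R := R))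
  refine hE S (LinearMap.ker p) (LinearMap.isCompl_of_proj hp) ⟨?_, fun A B h => ?_⟩
  · exact IsSimpleModule.nontrivial R S
  · rcases eq_bot_or_eq_top A with hA | hA
    · exact Or.inl hA
    · right
      rw [hA] at h
      exact top_disjoint.1 h.disjoint

end AbsolutelyFlat

/-! ### Injective hulls as maximal essential extensions inside an injective module. -/

section InjectiveHull

variable {R : Type u} [CommRing R]

/-- `N` is an essential extension of its submodule `M` (both inside an ambient module). -/
def Submodule.IsEssentialExtension {Q : Type u} [AddCommGroup Q] [Module R Q]
    (M N : Submodule R Q) : Prop :=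
  M ≤ N ∧ ∀ T ≤ N, Disjoint M T → T = ⊥

/-- Zorn's lemma applies because essentiality can be tested on cyclic submodules, and each cyclic
submodule of the union of a chain lies in one member. -/
theorem Submodule.exists_maximal_isEssentialExtension {Q : Type u} [AddCommGroup Q] [Module R Q]
    (M : Submodule R Q) : ∃ E, Maximal M.IsEssentialExtension E := by
  obtain ⟨E, -, hE⟩ := zorn_le_nonempty₀ {N | M.IsEssentialExtension N} (fun c hc hchain N₀ hN₀ => by
    refine ⟨sSup c, ⟨(hc hN₀).1.trans (le_sSup hN₀), fun T hT hMT => ?_⟩, fun _ => le_sSup⟩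
    rw [Submodule.eq_bot_iff]
    intro x hx
    obtain ⟨N, hN, hxN⟩ := (Submodule.mem_sSup_of_directed ⟨N₀, hN₀⟩ hchain.directedOn).1 (hT hx)
    have := (hc hN).2 (Submodule.span R {x}) (by simpa using hxN)
      (hMT.mono_right (by simpa using hx))
    simpa using this) M ⟨le_rfl, fun T hT h => by simpa using h.mono_left hT⟩
  exact ⟨E, hE⟩

theorem Module.Injective.of_isCompl {Q : Type u} [AddCommGroup Q] [Module R Q]
    (hQ : Module.Injective R Q) {E C : Submodule R Q} (h : IsCompl E C) :
    Module.Injective R E where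
  out X Y _ _ _ _ f hf g := by
    obtain ⟨k, hk⟩ := hQ.out f hf (E.subtype ∘ₗ g)
    refine ⟨E.projectionOnto C h ∘ₗ k, fun x => ?_⟩
    rw [LinearMap.comp_apply, hk]
    simp

/-- A maximal essential extension inside an injective module is injective. -/
theorem Submodule.injective_of_maximal_isEssentialExtension {Q : Type u} [AddCommGroup Q]
    [Module R Q] (hQ : Module.Injective R Q) {M E : Submodule R Q}
    (hE : Maximal M.IsEssentialExtension E) : Module.Injective R E := by
  -- Take `C` maximal among the submodules disjoint from `E`. Then `E` embeds in `Q ⧸ C`, and its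
  -- inclusion into `Q` extends to `φ : Q ⧸ C → Q`. The image of `φ` turns out to be essential over
  -- `M`, so by maximality it is `E`, and `φ` provides a projection onto `E` with kernel `C`.
  obtain ⟨C, -, hC⟩ := zorn_le_nonempty₀ {C : Submodule R Q | Disjoint E C}
    (fun c hc hchain N₀ hN₀ => ⟨sSup c, by
      change Disjoint E (sSup c)
      rw [Submodule.disjoint_def]
      intro x hx hxc
      obtain ⟨N, hN, hxN⟩ := (Submodule.mem_sSup_of_directed ⟨N₀, hN₀⟩ hchain.directedOn).1 hxc
      exact Submodule.disjoint_def.1 (hc hN) x hx hxN, fun _ => le_sSup⟩) ⊥ disjoint_bot_right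
  have hEC : Disjoint E C := hC.prop
  let i : E →ₗ[R] Q ⧸ C := C.mkQ ∘ₗ E.subtype
  have hi : Function.Injective i := by
    rw [← LinearMap.ker_eq_bot, LinearMap.ker_eq_bot']
    intro x hx
    have : (x : Q) ∈ C := (Submodule.Quotient.mk_eq_zero C).1 hx
    exact Subtype.ext (Submodule.disjoint_def.1 hEC _ x.2 this)
  obtain ⟨φ, hφ⟩ := hQ.out i hi E.subtype
  have hφE : ∀ x ∈ E, φ (C.mkQ x) = x := fun x hx => hφ ⟨x, hx⟩
  have key : ∀ T : Submodule R Q, C ≤ T → Disjoint E T → T = C := fun T h h' =>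
    (hC.eq_of_le h' h).symm
  have hφinj : LinearMap.ker (φ ∘ₗ C.mkQ) = C := by
    refine key _ (fun x hx => ?_) (Submodule.disjoint_def.2 fun x hx hx' => ?_)
    · rw [LinearMap.mem_ker, LinearMap.comp_apply, Submodule.mkQ_apply,
        (Submodule.Quotient.mk_eq_zero C).2 hx, map_zero]
    · rw [← hφE x hx]; exact hx'
  have hle : E ≤ LinearMap.range (φ ∘ₗ C.mkQ) := fun x hx => ⟨x, hφE x hx⟩
  have hrange : M.IsEssentialExtension (LinearMap.range (φ ∘ₗ C.mkQ)) := by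
    refine ⟨hE.prop.1.trans hle, fun T hT hMT => ?_⟩
    have h1 : E ⊓ T = ⊥ := hE.prop.2 _ inf_le_left (hMT.mono_right inf_le_right)
    -- The preimage of `T` contains `C` and is disjoint from `E`, as `φ ∘ₗ C.mkQ` fixes `E` and `E ⊓
    -- T = ⊥`; maximality of `C` forces equality.
    have h2 : T.comap (φ ∘ₗ C.mkQ) = C := by
      refine key _ (fun x hx => ?_) (Submodule.disjoint_def.2 fun x hx hx' => ?_)
      · rw [← hφinj, LinearMap.mem_ker] at hx
        rw [Submodule.mem_comap, hx]
        exact zero_mem _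
      · rw [Submodule.mem_comap, LinearMap.comp_apply, hφE x hx] at hx'
        exact (Submodule.eq_bot_iff _).1 h1 x ⟨hx, hx'⟩
    rw [Submodule.eq_bot_iff]
    intro x hx
    obtain ⟨y, rfl⟩ := hT hx
    have hy : y ∈ C := by rw [← h2]; exact hx
    rw [← hφinj] at hy
    exact hy
  have hErange := hE.eq_of_le hrange hle
  refine Module.Injective.of_isCompl hQ (E := E) (C := C) (IsCompl.of_eq hEC.eq_bot ?_)
  rw [Submodule.eq_top_iff']
  intro x
  have hx : φ (C.mkQ x) ∈ E := by rw [hErange]; exact ⟨x, rfl⟩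
  refine Submodule.mem_sup.2 ⟨φ (C.mkQ x), hx, x - φ (C.mkQ x), hφinj.le ?_, by abel⟩
  rw [LinearMap.mem_ker, LinearMap.comp_apply, map_sub, map_sub, hφE _ hx, sub_self]

end InjectiveHull

/-- The hull of a module without simple submodules works: by essentiality an indecomposable summand
contains a nonzero element of that module, and the cyclic submodule it generates is simple. -/
theorem exists_injective_superdecomposable {R : Type u} [CommRing R] [IsAbsolutelyFlat R]
    (hR : ¬ IsSemiArtinian R) : ∃ (E : Type u) (_ : AddCommGroup E) (_ : Module R E),
      Nontrivial E ∧ Module.Injective R E ∧ IsSuperdecomposable R E := by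
  simp only [IsSemiArtinian, not_forall, not_exists] at hR
  -- That `M` is a quotient of `R` plays no role from here on.
  obtain ⟨M, _, _, -, -, hM, hsimple⟩ := hR
  let Q := CategoryTheory.Injective.under (ModuleCat.of R M)
  let j : M →ₗ[R] Q := (CategoryTheory.Injective.ι (ModuleCat.of R M)).hom
  have hj : Function.Injective j :=
    (ModuleCat.mono_iff_injective (CategoryTheory.Injective.ι (ModuleCat.of R M))).1 inferInstance
  have hQi : CategoryTheory.Injective (ModuleCat.of R Q) :=
    CategoryTheory.Injective.injective_under (ModuleCat.of R M)
  have hQ : Module.Injective R Q := Module.injective_module_of_injective_object R Q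
  obtain ⟨E, hE⟩ := (LinearMap.range j).exists_maximal_isEssentialExtension
  refine ⟨E, inferInstance, inferInstance, ?_,
    Submodule.injective_of_maximal_isEssentialExtension hQ hE, fun N N' _ hN => ?_⟩
  · obtain ⟨x, hx⟩ := exists_ne (0 : M)
    refine nontrivial_of_ne (⟨j x, hE.prop.1 ⟨x, rfl⟩⟩ : E) 0 fun h => hx (hj ?_)
    rw [map_zero]
    exact congrArg Subtype.val h
  · have hN0 : N.map E.subtype ≠ ⊥ := by
      intro h
      obtain rfl : N = ⊥ := Submodule.map_injective_of_injective E.injective_subtype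
        (h.trans (Submodule.map_bot _).symm)
      have := hN.1
      exact not_subsingleton (⊥ : Submodule R E) inferInstance
    have h : ¬ Disjoint (LinearMap.range j) (N.map E.subtype) := fun h =>
      hN0 (hE.prop.2 _ (Submodule.map_subtype_le E N) h)
    rw [Submodule.disjoint_def] at h
    push Not at h
    obtain ⟨_, ⟨m, rfl⟩, ⟨x, hx, hxm⟩, hm0⟩ := h
    have hx0 : x ≠ 0 := by
      rintro rfl
      exact hm0 (by rw [← hxm, map_zero])
    have hs := hN.isSimpleModule_span hx hx0
    have e1 : Submodule.span R {x} ≃ₗ[R] (Submodule.span R {x}).map E.subtype :=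
      Submodule.equivMapOfInjective _ E.injective_subtype _
    have e2 : Submodule.span R {m} ≃ₗ[R] (Submodule.span R {m}).map j :=
      Submodule.equivMapOfInjective _ hj _
    have e3 : (Submodule.span R {m}).map j = (Submodule.span R {x}).map E.subtype := by
      rw [Submodule.map_span, Submodule.map_span, Set.image_singleton, Set.image_singleton, hxm]
    exact hsimple (Submodule.span R {m})
      (IsSimpleModule.congr (e2.trans ((LinearEquiv.ofEq _ _ e3).trans e1.symm)))

/-! ### Maps that become injective after localization at a prime. -/

section LocallyInjective

variable {R : Type u} [CommRing R]

/-- Every element of the kernel of `f` is killed by some element outside `I`. For `I` a maximal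
ideal this says that the localization of `f` at `I` is injective. -/
def KernelKilledOutside (I : Ideal R) {A B : Type u} [AddCommGroup A] [AddCommGroup B]
    [Module R A] [Module R B] (f : A →ₗ[R] B) : Prop :=
  ∀ x, f x = 0 → ∃ a, a ∉ I ∧ a • x = 0

/-- By right exactness the kernel of `M ⊗ f` is generated by the tensors `m ⊗ z` with `z` in the
kernel of `f`. For a sum of tensors, multiply the killing elements; primeness keeps the product
outside `I`. -/
theorem KernelKilledOutside.lTensor {I : Ideal R} [I.IsPrime] {A B : Type u} [AddCommGroup A]
    [AddCommGroup B] [Module R A] [Module R B] {f : A →ₗ[R] B} (hf : KernelKilledOutside I f)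
    (hs : Function.Surjective f) (M : Type u) [AddCommGroup M] [Module R M] :
    KernelKilledOutside I (f.lTensor M) := by
  intro x hx
  obtain ⟨y, rfl⟩ := (lTensor_exact M (LinearMap.exact_subtype_ker_map f) hs x).1 hx
  clear hx
  induction y with
  | zero => exact ⟨1, (Ideal.ne_top_iff_one I).1 (Ideal.IsPrime.ne_top ‹_›), by simp⟩
  | tmul m z =>
    obtain ⟨a, ha, haz⟩ := hf z z.2
    exact ⟨a, ha, by
      rw [LinearMap.lTensor_tmul, ← TensorProduct.tmul_smul]
      exact (congrArg (m ⊗ₜ[R] ·) haz).trans (TensorProduct.tmul_zero _ _)⟩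
  | add y z hy hz =>
    obtain ⟨a, ha, hay⟩ := hy
    obtain ⟨b, hb, hbz⟩ := hz
    refine ⟨a * b, Ideal.IsPrime.mul_notMem ‹_› ha hb, ?_⟩
    rw [map_add, smul_add, mul_smul a b (LinearMap.lTensor M _ z), hbz, mul_comm, mul_smul, hay,
      smul_zero, smul_zero, add_zero]

/-- Supports are finite, so the product of the componentwise killing elements is available and
avoids the prime `I`. -/
theorem KernelKilledOutside.directSum {I : Ideal R} [I.IsPrime] {A B : ℤ → Type u}
    [∀ i, AddCommGroup (A i)] [∀ i, AddCommGroup (B i)] [∀ i, Module R (A i)]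
    [∀ i, Module R (B i)] {f : ∀ i, A i →ₗ[R] B i} (hf : ∀ i, KernelKilledOutside I (f i)) :
    KernelKilledOutside I (DirectSum.lmap f) := by
  classical
  intro x hx
  have h : ∀ i, ∃ a, a ∉ I ∧ a • x i = 0 := fun i => hf i _ (by
    rw [← DirectSum.lmap_apply, hx]; rfl)
  choose a ha hax using h
  refine ⟨∏ i ∈ x.support, a i, fun h => ?_, DFinsupp.ext fun i => ?_⟩
  · obtain ⟨i, -, hi⟩ := (Ideal.IsPrime.prod_mem_iff).1 h
    exact ha i hi
  · change (∏ i ∈ x.support, a i) • x i = 0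
    by_cases hi : i ∈ x.support
    · rw [← Finset.prod_erase_mul _ _ hi, mul_smul, hax, smul_zero]
    · rw [DFinsupp.notMem_support_iff.1 hi, smul_zero]

theorem surjective_and_kernelKilledOutside_of_equiv {I : Ideal R} {A B A' B' : Type u}
    [AddCommGroup A] [AddCommGroup B] [AddCommGroup A'] [AddCommGroup B']
    [Module R A] [Module R B] [Module R A'] [Module R B'] {f : A →ₗ[R] B} {f' : A' →ₗ[R] B'}
    (eA : A ≃ₗ[R] A') (eB : B ≃ₗ[R] B') (h : ∀ x, eB (f x) = f' (eA x))
    (hs : Function.Surjective f') (hf : KernelKilledOutside I f') :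
    Function.Surjective f ∧ KernelKilledOutside I f := by
  constructor
  · intro y
    obtain ⟨x, hxy⟩ := hs (eB y)
    refine ⟨eA.symm x, eB.injective ?_⟩
    rw [h, LinearEquiv.apply_symm_apply, hxy]
  · intro x hx0
    obtain ⟨a, ha, hax⟩ := hf (eA x) (by rw [← h, hx0, map_zero])
    exact ⟨a, ha, eA.injective (by rw [map_smul, map_zero, hax])⟩

/-- For `r ∈ I`, the idempotent `1 - r * s` kills `r` and is outside `I`. For maximal `I` this
amounts to the localization of `R` at `I` being the residue field. -/
theorem IsAbsolutelyFlat.kernelKilledOutside_mkQ [IsAbsolutelyFlat R] (I : Ideal R)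
    (hI : I ≠ ⊤) : KernelKilledOutside I (Submodule.mkQ I) := by
  intro r hr
  have hr : r ∈ I := (Submodule.Quotient.mk_eq_zero I).1 hr
  obtain ⟨s, -, h⟩ := IsAbsolutelyFlat.exists_idempotent r
  refine ⟨1 - r * s, fun h1 => hI ((Ideal.eq_top_iff_one I).2 ?_), ?_⟩
  · have := I.add_mem h1 (I.mul_mem_right s hr)
    rwa [sub_add_cancel] at this
  · rw [smul_eq_mul, sub_mul, one_mul, h, sub_self]

end LocallyInjective

/-! ### Acyclicity of tensor products of complexes, checked at maximal ideals. -/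

section Complexes

open CategoryTheory MonoidalCategory

variable {R : Type u} [CommRing R]

/-- Surjectivity in all degrees, and local injectivity at `I`, pass to tensor products with a
complex. -/
theorem tensorHom_surjective_and_kernelKilledOutside {I : Ideal R} [I.IsPrime]
    (K : CochainComplex (ModuleCat.{u} R) ℤ) {A B : CochainComplex (ModuleCat.{u} R) ℤ}
    (f : A ⟶ B) (hs : ∀ n, Function.Surjective (f.f n).hom)
    (hf : ∀ n, KernelKilledOutside I (f.f n).hom) (n : ℤ) :
    Function.Surjective ((HomologicalComplex.tensorHom (𝟙 K) f).f n).hom ∧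
      KernelKilledOutside I ((HomologicalComplex.tensorHom (𝟙 K) f).f n).hom := by
  have hm := TensorAux.tensorXIso_hom_map (𝟙 K) f n
  have hi : ∀ i, (((𝟙 K : K ⟶ K).f i ⊗ₘ f.f (n - i))).hom =
      (f.f (n - i)).hom.lTensor (K.X i) := fun i => by
    rw [HomologicalComplex.id_f, MonoidalCategory.id_tensorHom]
    rfl
  have hd : (TensorAux.dmap fun i => (𝟙 K : K ⟶ K).f i ⊗ₘ f.f (n - i)).hom =
      DirectSum.lmap fun i => (f.f (n - i)).hom.lTensor (K.X i) := by
    simp only [TensorAux.dmap, hi]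
    rfl
  refine surjective_and_kernelKilledOutside_of_equiv (TensorAux.tensorXIso K A n).toLinearEquiv
    (TensorAux.tensorXIso K B n).toLinearEquiv
    (f' := DirectSum.lmap fun i => (f.f (n - i)).hom.lTensor (K.X i)) (fun x => ?_)
    ((DirectSum.lmap_surjective _).2 fun i => LinearMap.lTensor_surjective (K.X i) (hs (n - i)))
    (KernelKilledOutside.directSum fun i => (hf (n - i)).lTensor (hs (n - i)) (K.X i))
  rw [← hd]
  exact congr($hm x)

theorem exactAt_iff_forall (K : CochainComplex (ModuleCat.{u} R) ℤ) (n : ℤ) :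
    K.ExactAt n ↔ ∀ x : K.X n, K.d n (n + 1) x = 0 → ∃ y, K.d (n - 1) n y = x := by
  rw [K.exactAt_iff' (n - 1) n (n + 1) (by simp) (by simp), ShortComplex.moduleCat_exact_iff]
  rfl

/-- Acyclicity can be checked after degreewise surjective, locally injective maps to acyclic
complexes, one for each maximal ideal. -/
theorem acyclic_of_forall_maximal {P : CochainComplex (ModuleCat.{u} R) ℤ}
    (h : ∀ (m : Ideal R) (_ : m.IsMaximal), ∃ (S : CochainComplex (ModuleCat.{u} R) ℤ)
      (f : P ⟶ S), S.Acyclic ∧ ∀ n, Function.Surjective (f.f n).hom ∧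
        KernelKilledOutside m (f.f n).hom) : P.Acyclic := by
  intro n
  rw [exactAt_iff_forall]
  intro z hz
  -- `J` consists of the scalars `r` for which `r • z` is a boundary.
  let J : Ideal R := (LinearMap.range (P.d (n - 1) n).hom).comap (LinearMap.toSpanSingleton R _ z)
  suffices hJ : J = ⊤ by
    obtain ⟨y, hy⟩ := (Ideal.eq_top_iff_one J).1 hJ
    exact ⟨y, hy.trans (one_smul R z)⟩
  by_contra hJ
  obtain ⟨m, hm, hJm⟩ := Ideal.exists_le_maximal J hJ
  obtain ⟨S, f, hS, hf⟩ := h m hm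
  have comm : ∀ i j x, f.f j (P.d i j x) = S.d i j (f.f i x) := fun i j x =>
    congr($((f.comm i j).symm) x)
  obtain ⟨w, hw⟩ := (exactAt_iff_forall S n).1 (hS n) (f.f n z) (by
    rw [← comm, hz, map_zero])
  -- The image of `z` bounds in `S`; lifting the bounding element to `y` puts `z - d y` in the
  -- kernel of `f`. Some `a ∉ m` kills it, so `a • z = d (a • y)` and `a ∈ J ≤ m`, a contradiction.
  obtain ⟨y, rfl⟩ := (hf (n - 1)).1 w
  obtain ⟨a, ha, haz⟩ := (hf n).2 (z - P.d (n - 1) n y) (by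
    rw [map_sub, sub_eq_zero]
    exact hw.symm.trans (comm _ _ _).symm)
  refine ha (hJm ⟨a • y, ?_⟩)
  rw [smul_sub, sub_eq_zero] at haz
  rw [map_smul]
  exact haz.symm

theorem single_map_surjective_and_kernelKilledOutside {I : Ideal R} [I.IsPrime]
    {A B : ModuleCat.{u} R} (f : A ⟶ B) (hs : Function.Surjective f.hom)
    (hf : KernelKilledOutside I f.hom) (n : ℤ) :
    Function.Surjective (((CochainComplex.singleFunctor _ 0).map f).f n).hom ∧
      KernelKilledOutside I (((CochainComplex.singleFunctor _ 0).map f).f n).hom := by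
  by_cases hn : n = 0
  · subst hn
    refine surjective_and_kernelKilledOutside_of_equiv
      (HomologicalComplex.singleObjXSelf (ComplexShape.up ℤ) 0 A).toLinearEquiv
      (HomologicalComplex.singleObjXSelf (ComplexShape.up ℤ) 0 B).toLinearEquiv
      (fun x => ?_) hs hf
    have : ((CochainComplex.singleFunctor _ 0).map f).f 0 ≫
        (HomologicalComplex.singleObjXSelf (ComplexShape.up ℤ) 0 B).hom =
        (HomologicalComplex.singleObjXSelf (ComplexShape.up ℤ) 0 A).hom ≫ f := by
      change ((HomologicalComplex.single _ (ComplexShape.up ℤ) 0).map f).f 0 ≫ _ = _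
      simp [HomologicalComplex.single_map_f_self]
    exact congr($this x)
  · have h : ∀ A : ModuleCat.{u} R,
        Subsingleton (((CochainComplex.singleFunctor (ModuleCat.{u} R) 0).obj A).X n) := fun A =>
      ModuleCat.subsingleton_of_isZero
        (HomologicalComplex.isZero_single_obj_X (ComplexShape.up ℤ) 0 A n hn)
    have := h A
    have := h B
    exact ⟨fun y => ⟨0, Subsingleton.elim _ _⟩, fun x _ =>
      ⟨1, (Ideal.ne_top_iff_one I).1 (Ideal.IsPrime.ne_top ‹_›), Subsingleton.elim _ _⟩⟩

variable [HasDerivedCategory.{w} (ModuleCat.{u} R)]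

theorem isZero_Q_obj_iff (K : CochainComplex (ModuleCat.{u} R) ℤ) :
    Limits.IsZero (DerivedCategory.Q.obj K) ↔ K.Acyclic := by
  constructor
  · intro h n
    rw [HomologicalComplex.exactAt_iff_isZero_homology]
    exact ((DerivedCategory.homologyFunctor _ n).map_isZero h).of_iso
      ((DerivedCategory.homologyFunctorFactors _ n).symm.app K)
  · intro h
    have hZ := Limits.isZero_zero (CochainComplex (ModuleCat.{u} R) ℤ)
    have : QuasiIso (hZ.from_ K) := ⟨fun n => by
      rw [quasiIsoAt_iff_exactAt' _ _ (HomologicalComplex.acyclic_of_isZero _ hZ n)]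
      exact h n⟩
    exact (DerivedCategory.Q.map_isZero hZ).of_iso (asIso (DerivedCategory.Q.map (hZ.from_ K)))

/-- The derived tensor product is computed by the tensor product of complexes. -/
theorem derivedTensor_obj_Q_iso [IsAbsolutelyFlat R] (X : DerivedCategory (ModuleCat.{u} R))
    (A : CochainComplex (ModuleCat.{u} R) ℤ) :
    Nonempty ((derivedTensor X).obj (DerivedCategory.Q.obj A) ≅
      DerivedCategory.Q.obj (DerivedCategory.Q.objPreimage X ⊗ A)) := by
  let K := DerivedCategory.Q.objPreimage X
  let W := HomologicalComplex.quasiIso (ModuleCat.{u} R) (ComplexShape.up ℤ)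
  -- Tensoring with `K` inverts quasi-isomorphisms, so its factorization through the localization is
  -- also a left derived functor; uniqueness compares the two.
  let e := Functor.leftDerivedUnique
    (Localization.lift _ (tensorLeft_isInvertedBy K) DerivedCategory.Q)
    ((tensorLeft K ⋙ DerivedCategory.Q).totalLeftDerived DerivedCategory.Q W)
    (α := (tensorLeft K ⋙ DerivedCategory.Q).totalLeftDerivedCounit DerivedCategory.Q W)
    (α'₂ := (Localization.fac _ (tensorLeft_isInvertedBy K) DerivedCategory.Q).hom) (W := W)
  exact ⟨e.app _ ≪≫ (Localization.fac _ (tensorLeft_isInvertedBy K) DerivedCategory.Q).app A⟩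

theorem bousfieldClass_moduleInDerived_iff [IsAbsolutelyFlat R]
    (X : DerivedCategory (ModuleCat.{u} R)) (M : Type u) [AddCommGroup M] [Module R M] :
    bousfieldClass X (moduleInDerived (R := R) M) ↔
      (HomologicalComplex.tensorObj (DerivedCategory.Q.objPreimage X)
        ((CochainComplex.singleFunctor _ 0).obj (ModuleCat.of R M))).Acyclic := by
  obtain ⟨e⟩ := derivedTensor_obj_Q_iso X
    ((CochainComplex.singleFunctor _ 0).obj (ModuleCat.of R M))
  rw [← isZero_Q_obj_iff]
  exact (((derivedTensor X).mapIso ((DerivedCategory.singleFunctorIsoCompQ _ 0).app _)) ≪≫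
    e).isZero_iff

/-- If the Bousfield class of `X` contains all residue fields, it contains `R`. -/
theorem bousfieldClass_self_of_residue [IsAbsolutelyFlat R]
    (X : DerivedCategory (ModuleCat.{u} R))
    (h : ∀ m : Ideal R, m.IsMaximal → bousfieldClass X (moduleInDerived (R := R) (R ⧸ m))) :
    bousfieldClass X (moduleInDerived (R := R) R) := by
  rw [bousfieldClass_moduleInDerived_iff]
  refine acyclic_of_forall_maximal fun m hm =>
    ⟨_, HomologicalComplex.tensorHom (𝟙 _)
      ((CochainComplex.singleFunctor _ 0).map (ModuleCat.ofHom (Submodule.mkQ m))),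
      (bousfieldClass_moduleInDerived_iff X (R ⧸ m)).1 (h m hm), ?_⟩
  have := hm.isPrime
  have hq := single_map_surjective_and_kernelKilledOutside (I := m)
    (ModuleCat.ofHom (Submodule.mkQ m)) (Submodule.mkQ_surjective m)
    (IsAbsolutelyFlat.kernelKilledOutside_mkQ m hm.ne_top)
  exact tensorHom_surjective_and_kernelKilledOutside _ _ (fun n => (hq n).1) fun n => (hq n).2

end Complexes

/-! ### Cohomological Bousfield classes and the comparison with Bousfield classes. -/

section CohomologicalBousfield

open CategoryTheory

variable {R : Type u} [CommRing R] [HasDerivedCategory.{w} (ModuleCat.{u} R)]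

/-- Left orthogonals of shift-stable properties are known to be triangulated and closed under
isomorphisms. -/
theorem cohomologicalBousfieldClass_eq_leftOrthogonal (X : DerivedCategory (ModuleCat.{u} R)) :
    cohomologicalBousfieldClass X =
      ((ObjectProperty.singleton X).shiftClosure ℤ).leftOrthogonal := by
  ext Y
  constructor
  · rintro h Z f ⟨_, i, e, ⟨⟩⟩
    rw [← cancel_mono e.hom, h i (f ≫ e.hom), Limits.zero_comp]
  · intro h i f
    exact h f ⟨X, i, Iso.refl _, by simp⟩

theorem isLocalising_cohomologicalBousfieldClass (X : DerivedCategory (ModuleCat.{u} R)) :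
    IsLocalising (cohomologicalBousfieldClass X) where
  isTriangulated := by
    rw [cohomologicalBousfieldClass_eq_leftOrthogonal]
    infer_instance
  isClosedUnderIsomorphisms := by
    rw [cohomologicalBousfieldClass_eq_leftOrthogonal]
    infer_instance
  isClosedUnderCoproducts J := ⟨by
    rintro Y ⟨c⟩ i f
    -- A map out of a coproduct vanishes once it vanishes on every summand.
    exact c.isColimit.hom_ext fun j => by
      rw [Limits.comp_zero]
      exact c.prop_diag_obj j i _⟩

/-- Without nonzero module homomorphisms from `M` to an injective module `E`, there are no
nonzero maps from `M` to shifts of `E` in the derived category. -/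
theorem cohomologicalBousfieldClass_of_forall_eq_zero {M E : Type u} [AddCommGroup M]
    [Module R M] [AddCommGroup E] [Module R E] [Module.Injective R E]
    (h : ∀ f : M →ₗ[R] E, f = 0) :
    cohomologicalBousfieldClass (moduleInDerived (R := R) E) (moduleInDerived (R := R) M) := by
  intro i f
  have : Injective (ModuleCat.of R E) := Module.injective_object_of_injective_module R E
  let := hasExt_of_hasDerivedCategory (ModuleCat.{u} R)
  obtain ⟨n, rfl⟩ | ⟨n, hn, rfl⟩ : (∃ n : ℕ, i = n) ∨ ∃ n : ℤ, 0 < n ∧ i = -n := by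
    rcases le_or_gt 0 i with hi | hi
    · exact Or.inl ⟨i.toNat, by lia⟩
    · exact Or.inr ⟨-i, by lia, by lia⟩
  -- For `n ≥ 0` the maps are elements of Ext^n(M, E): degree zero is the hypothesis, positive
  -- degrees vanish by injectivity.
  · suffices ∀ g : Abelian.Ext (ModuleCat.of R M) (ModuleCat.of R E) n, g = 0 by
      obtain ⟨g, rfl⟩ := (Abelian.Ext.homEquiv (X := ModuleCat.of R M)
        (Y := ModuleCat.of R E) (n := n)).surjective f
      rw [this g]
      exact Abelian.Ext.zero_hom _ _ _
    intro g
    cases n with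
    | zero =>
      rw [← Abelian.Ext.mk₀_homEquiv₀_apply g]
      rw [show Abelian.Ext.homEquiv₀ g = 0 from ModuleCat.hom_ext (h _), Abelian.Ext.mk₀_zero]
    | succ n => exact Abelian.Ext.eq_zero_of_injective g
  -- A negative shift places `E` in the positive degree `n`, while `M` sits in degree 0; the
  -- t-structure allows no nonzero map.
  · let e := ((DerivedCategory.singleFunctors (ModuleCat.{u} R)).shiftIso (-n : ℤ) n 0
      (by lia)).app (ModuleCat.of R E)
    have : f ≫ e.hom = 0 := DerivedCategory.TStructure.t.zero_of_isLE_of_isGE _ 0 n (by lia)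
      (inferInstanceAs (((DerivedCategory.singleFunctor _ 0).obj (ModuleCat.of R M)).IsLE 0))
      (inferInstanceAs (((DerivedCategory.singleFunctor _ n).obj (ModuleCat.of R E)).IsGE n))
    exact (cancel_mono e.hom).1 (this.trans Limits.zero_comp.symm)

theorem forall_eq_zero_of_cohomologicalBousfieldClass {M E : Type u} [AddCommGroup M]
    [Module R M] [AddCommGroup E] [Module R E]
    (h : cohomologicalBousfieldClass (moduleInDerived (R := R) E) (moduleInDerived (R := R) M))
    (f : M →ₗ[R] E) : f = 0 := by
  let g : moduleInDerived (R := R) M ⟶ moduleInDerived (R := R) E :=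
    (DerivedCategory.singleFunctor _ 0).map (ModuleCat.ofHom f)
  -- The hypothesis concerns maps into the shift by 0, which is only isomorphic to the identity,
  -- hence the composition.
  have hg : g = 0 :=
    (cancel_mono ((shiftFunctorZero (DerivedCategory (ModuleCat.{u} R)) ℤ).inv.app _)).1
      ((h 0 _).trans Limits.zero_comp.symm)
  have h1 : ModuleCat.ofHom f = 0 :=
    (DerivedCategory.singleFunctor (ModuleCat.{u} R) 0).map_injective
      (hg.trans (Functor.map_zero _ _ _).symm)
  exact congr(($h1).hom)

theorem not_isBousfieldClass_of_superdecomposable [IsAbsolutelyFlat R] (E : Type u)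
    [AddCommGroup E] [Module R E] [Nontrivial E] [Module.Injective R E]
    (hE : IsSuperdecomposable R E) :
    ¬ IsBousfieldClass (cohomologicalBousfieldClass (moduleInDerived (R := R) E)) := by
  rintro ⟨X, hX⟩
  have h := bousfieldClass_self_of_residue X fun m hm => by
    rw [← hX]
    refine cohomologicalBousfieldClass_of_forall_eq_zero fun f => ?_
    have : IsSimpleModule R (R ⧸ m) := isSimpleModule_iff_isCoatom.2 hm.out
    -- A nonzero map from the simple module `R ⧸ m` would embed it in `E`.
    rcases LinearMap.injective_or_eq_zero f with hf | hf
    · exact absurd (IsSimpleModule.congr (LinearEquiv.ofInjective f hf).symm)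
        (hE.not_isSimpleModule _)
    · exact hf
  rw [← hX] at h
  -- Now `R` lies in ⊥E, although `r ↦ r • x` is a nonzero map to `E`.
  obtain ⟨x, hx⟩ := exists_ne (0 : E)
  refine hx ?_
  have := forall_eq_zero_of_cohomologicalBousfieldClass h (LinearMap.toSpanSingleton R E x)
  simpa using congr($this 1)

end CohomologicalBousfield

theorem mainTheorem5 (R : Type u) [CommRing R] [IsAbsolutelyFlat R]
    [HasDerivedCategory.{w} (ModuleCat.{u} R)] (hR : ¬ IsSemiArtinian R) :
    (∃ (E : Type u) (_ : AddCommGroup E) (_ : Module R E),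
      Nontrivial E ∧ Module.Injective R E ∧ IsSuperdecomposable R E) ∧
    (∀ (E : Type u) [AddCommGroup E] [Module R E],
      Nontrivial E → Module.Injective R E → IsSuperdecomposable R E →
        IsLocalising (cohomologicalBousfieldClass (moduleInDerived (R := R) E)) ∧
        IsCohomologicalBousfieldClass (cohomologicalBousfieldClass (moduleInDerived (R := R) E)) ∧
        ¬ IsBousfieldClass (cohomologicalBousfieldClass (moduleInDerived (R := R) E))) ∧
    (∃ L : CategoryTheory.ObjectProperty (DerivedCategory (ModuleCat.{u} R)),
      IsLocalising L ∧ IsCohomologicalBousfieldClass L ∧ ¬ IsBousfieldClass L) := by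
  have h : ∀ (E : Type u) [AddCommGroup E] [Module R E],
      Nontrivial E → Module.Injective R E → IsSuperdecomposable R E →
        IsLocalising (cohomologicalBousfieldClass (moduleInDerived (R := R) E)) ∧
        IsCohomologicalBousfieldClass (cohomologicalBousfieldClass (moduleInDerived (R := R) E)) ∧
        ¬ IsBousfieldClass (cohomologicalBousfieldClass (moduleInDerived (R := R) E)) :=
    fun E _ _ _ _ hE => ⟨isLocalising_cohomologicalBousfieldClass _, ⟨_, rfl⟩,
      not_isBousfieldClass_of_superdecomposable E hE⟩
  refine ⟨exists_injective_superdecomposable hR, h, ?_⟩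
  obtain ⟨E, _, _, h1, h2, h3⟩ := exists_injective_superdecomposable hR
  exact ⟨_, h E h1 h2 h3⟩
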